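/- All digraphs are finite and have neither loops nor multiple edges; a component of a digraph is a strongly connected component, identified with its vertex set. The \emph{directed tree-width (component) game} on a digraph $G$ is played as follows. At the start no cops are on the graph, $C_0=\emptyset$, and the robber chooses a component $R_0$ of $G$. In round $i+1$, from the position $(C_i,R_i)$ with $R_i\neq\emptyset$, the cops announce a set $C_{i+1}\subseteq V(G)$, and the robber then chooses a component $R_{i+1}$ of $G-C_{i+1}$ such that $R_i$ and $R_{i+1}$ are contained in the same component of $G-(C_i\cap C_{i+1})$; if there is no such component (at the start: if $G$ has no vertices), the robber is captured, which is written $R_{i+1}=\emptyset$ (respectively $R_0=\emptyset$), and the play ends. Infinite plays are won by the robber. A cop strategy determines $C_{i+1}$ from the sequence of positions $(C_0,R_0),\dots,(C_i,R_i)$; it is winning if the robber is captured in every play consistent with it, and it uses at most $k$ cops if $|C_i|\le k$ for every cop set $C_i$ in every consistent play. A play is \emph{cop-monotone} if $C_i\cap C_k\subseteq C_j$ for all $i<j<k$, that is, if the cops never reoccupy a vertex; a strategy is cop-monotone if all plays consistent with it are. Let $\mathrm{dTW}(G)$ be the least $k$ such that the cops have a winning strategy using at most $k$ cops in the component game on $G$,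 and let $\mathrm{cmdTW}(G)$ be the least $k$ such that they have a cop-monotone winning strategy using at most $k$ cops. The number $\mathrm{cmdTW}(G)-\mathrm{dTW}(G)$ is the \emph{cop-monotonicity cost} for the component game on $G$. \textbf{Theorem.} There is a family $\{G_n \mid n>2\}$ of digraphs such that for all $n>2$ \[ \mathrm{dTW}(G_n)\le 4 \qquad\text{and}\qquad \mathrm{cmdTW}(G_n)\ge n. \] Consequently, the cop-monotonicity cost for the component game is unbounded on $\{G_n \mid n>2\}$: for every $c\in\mathbb{N}$ there is $n>2$ with $\mathrm{cmdTW}(G_n)-\mathrm{dTW}(G_n)\ge c$. -/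

import Mathlib

namespace ComponentGame

/-- The subgraph of `G` induced by the vertex set `S` is strongly connected: any two vertices of
`S` are joined by a directed path that stays in `S`. -/
def StronglyConnectedOn {V : Type*} (G : Digraph V) (S : Set V) : Prop :=
  ∀ u ∈ S, ∀ v ∈ S, Relation.ReflTransGen (fun a b => a ∈ S ∧ b ∈ S ∧ G.Adj a b) u v

/-- `R` is (the vertex set of) a strongly connected component of `G - X`. -/
def IsComponent {V : Type*} (G : Digraph V) (X R : Set V) : Prop :=
  Maximal (fun S : Set V => S.Nonempty ∧ Disjoint S X ∧ StronglyConnectedOn G S) R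

/-- A position `(C, R)` in which the cops have to move. The value `R = ∅` means that the robber
has been captured; otherwise `R` is a component of `G - C`. -/
@[ext]
structure Pos (V : Type*) where
  /-- the set of vertices occupied by cops -/
  cops : Set V
  /-- the robber component -/
  robber : Set V

/-- The robber takes one of the options allowed by `legal`, and is captured (`R = ∅`) exactly when
there is no option. -/
def RobberChoice {V : Type*} (legal : Set V → Prop) (R : Set V) : Prop :=
  legal R ∨ (R = ∅ ∧ ∀ S, ¬ legal S)

/-- The robber moves of the component game: after the cops have announced their move from `C` to
`C'`, the robber may go from `R` to `R'` if `R'` is a component of `G - C'` and `R`, `R'` are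
contained in the same component of `G - (C ∩ C')`. -/
def RobberMove {V : Type*} (G : Digraph V) (C C' R R' : Set V) : Prop :=
  IsComponent G C' R' ∧ ∃ K, IsComponent G (C ∩ C') K ∧ R ⊆ K ∧ R' ⊆ K

/-- At the beginning there are no cops on the graph and the robber chooses a component of `G`. -/
def IsStart {V : Type*} (G : Digraph V) (s : Pos V) : Prop :=
  s.cops = ∅ ∧ RobberChoice (IsComponent G ∅) s.robber

/-- One round: the cops move from `s.cops` to an arbitrary set `t.cops`, and the robber answers.
No round starts after the robber has been captured. -/
def IsRound {V : Type*} (G : Digraph V) (s t : Pos V) : Prop :=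
  s.robber.Nonempty ∧ RobberChoice (RobberMove G s.cops t.cops s.robber) t.robber

/-- A strategy for the cops: the next cop set, given the list of all positions so far. -/
abbrev Strategy (V : Type*) := List (Pos V) → Set V

/-- The history `p 0, …, p i`. -/
def history {V : Type*} (p : ℕ → Pos V) (i : ℕ) : List (Pos V) :=
  (List.range (i + 1)).map p

/-- `p 0, …, p m` is an initial segment of a play of the component game on `G` that is consistent
with the cop strategy `σ`. -/
def IsPlay {V : Type*} (G : Digraph V) (σ : Strategy V) (p : ℕ → Pos V) (m : ℕ) : Prop :=
  IsStart G (p 0) ∧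
    ∀ i < m, (p (i + 1)).cops = σ (history p i) ∧ IsRound G (p i) (p (i + 1))

/-- The finite play `p 0, …, p m` is cop-monotone: the cops never reoccupy a vertex. -/
def CopMonotone {V : Type*} (p : ℕ → Pos V) (m : ℕ) : Prop :=
  ∀ i j k, i < j → j < k → k ≤ m → (p i).cops ∩ (p k).cops ⊆ (p j).cops

/-- The strategy `σ` uses at most `k` cops and wins the component game on `G` with monotonicity
condition `Mon` (a property of finite plays `p 0, …, p m`): no consistent play is infinite, and
every consistent play that ends with the capture of the robber satisfies `Mon`. -/
def IsWinning {V : Type*} (G : Digraph V) (Mon : (ℕ → Pos V) → ℕ → Prop) (k : ℕ)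
    (σ : Strategy V) : Prop :=
  (∀ p m, IsPlay G σ p m → ∀ i ≤ m, (p i).cops.encard ≤ k) ∧
  (¬ ∃ p, ∀ m, IsPlay G σ p m) ∧
  (∀ p m, IsPlay G σ p m → (p m).robber = ∅ → Mon p m)

/-- Occupying all vertices at once wins, and does so cop-monotonically. Hence the minima below
are taken over nonempty sets when `V` is finite. -/
theorem exists_isWinning {V : Type*} [Finite V] (G : Digraph V)
    (Mon : (ℕ → Pos V) → ℕ → Prop) (hMon : ∀ p m, CopMonotone p m → Mon p m) :
    ∃ k σ, IsWinning G Mon k σ := by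
  have key : ∀ (p : ℕ → Pos V) (m : ℕ), IsPlay G (fun _ => Set.univ) p m → m ≤ 1 := by
    intro p m h
    by_contra hm
    obtain ⟨h0, -, h2⟩ := h.2 0 (by omega)
    obtain ⟨-, h4, -⟩ := h.2 1 (by omega)
    rcases h2 with h2 | h2
    · have h5 := h2.1.prop.2.1
      rw [h0, Set.disjoint_univ] at h5
      rw [h5] at h4
      exact Set.not_nonempty_empty h4
    · rw [h2.1] at h4
      exact Set.not_nonempty_empty h4
  refine ⟨Nat.card V, fun _ => Set.univ, ?_, ?_, ?_⟩
  · intro p m _ i _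
    calc (p i).cops.encard ≤ (Set.univ : Set V).encard := Set.encard_le_encard (Set.subset_univ _)
      _ = Nat.card V := by rw [Set.encard_univ, ENat.card_eq_coe_natCard]
  · rintro ⟨p, hp⟩
    have := key p 2 (hp 2)
    omega
  · intro p m h _
    refine hMon p m ?_
    intro i j k hij hjk hkm
    have := key p m h
    omega

/-- The minimal number of cops needed to win the component game (the directed tree-width game)
on `G`; the monotonicity condition consists of all finite plays. -/
noncomputable def dtwCops {V : Type*} (G : Digraph V) : ℕ :=
  sInf {k | ∃ σ, IsWinning G (fun _ _ => True) k σ}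

/-- The minimal number of cops needed to win the component game on `G` cop-monotonically. -/
noncomputable def cmDtwCops {V : Type*} (G : Digraph V) : ℕ :=
  sInf {k | ∃ σ, IsWinning G CopMonotone k σ}

/-- The cop-monotonicity cost for the component game on `G`. -/
noncomputable def copMonotonicityCost {V : Type*} (G : Digraph V) : ℤ :=
  (cmDtwCops G : ℤ) - (dtwCops G : ℤ)

theorem dtwCops_spec {V : Type*} [Finite V] (G : Digraph V) :
    ∃ σ, IsWinning G (fun _ _ => True) (dtwCops G) σ :=
  Nat.sInf_mem (exists_isWinning G _ fun _ _ _ => trivial)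

theorem cmDtwCops_spec {V : Type*} [Finite V] (G : Digraph V) :
    ∃ σ, IsWinning G CopMonotone (cmDtwCops G) σ :=
  Nat.sInf_mem (exists_isWinning G _ fun _ _ h => h)

end ComponentGame

namespace ComponentGame

/-! Every tree vertex other than the root has a guard: at most two depths of ancestors, with a
direction. Apart from arcs at its parent, the arcs that enter its subtree (direction `true`) or
leave it (direction `false`) have their outer end in the guard. Blocking one direction is enough to
confine a strongly connected set, so cops on the guard and the parent hold the robber in the subtree
(`subtree_of_stronglyConnectedOn`). Two consecutive guards comprise at most three depths, so four
cops can push the robber down the tree, going back to ancestors whenever a new guard requires it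
(`ChaseInv.step`).

Cop-monotone cops cannot go back, and a vertex they have left must never rejoin the robber component
(`IsWinning.notMem_robber`). Suppose that there are fewer than `n` of them. The robber waits at a
vertex until it is occupied, then moves to a child; each child has `n` copies, so one is free. On a
path of `n` vertices passed in this way, the cops have left at least one. Below `v` the robber first
uses guards of direction `false`, until some `p` with an arc from `v` has been left, and then guards
of direction `true` naming `p`, until some `q` with an arc to `v` has been left. From below `q` he
has the closed walk robber → `q` → `v` → `p` → robber, so the cops can never leave `v`. Vertices
pinned down earlier have their walks rerouted through the new `p` and `q`, so a guard of one depth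
serves them all (`Forced.exists_succ`). After `n` phases `n` vertices are pinned down, which is too
many. -/

/-- The arcs of `G - X`. -/
def AdjAvoiding {V : Type*} (G : Digraph V) (X : Set V) (a b : V) : Prop :=
  a ∉ X ∧ b ∉ X ∧ G.Adj a b

/-- The vertices that are joined to `v` by paths of `G - X` in both directions. -/
def scc {V : Type*} (G : Digraph V) (X : Set V) (v : V) : Set V :=
  {u | Relation.ReflTransGen (AdjAvoiding G X) v u ∧ Relation.ReflTransGen (AdjAvoiding G X) u v}

/-! ### Strong components and robber moves -/

section Scc

variable {V : Type*} {G : Digraph V} {X Y R S : Set V} {u v w : V}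

theorem self_mem_scc : v ∈ scc G X v := ⟨.refl, .refl⟩

theorem StronglyConnectedOn.subset_scc (hS : StronglyConnectedOn G S) (hd : Disjoint S X)
    (hv : v ∈ S) : S ⊆ scc G X v := by
  have key : ∀ a b, (a ∈ S ∧ b ∈ S ∧ G.Adj a b) → AdjAvoiding G X a b := fun a b h =>
    ⟨Set.disjoint_left.1 hd h.1, Set.disjoint_left.1 hd h.2.1, h.2.2⟩
  exact fun u hu => ⟨Relation.ReflTransGen.mono key _ _ (hS v hv u hu), Relation.ReflTransGen.mono key _ _ (hS u hu v hv)⟩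

/-- A path between two members of the class consists of members, because each of its vertices lies
on a closed walk through `v`. -/
theorem stronglyConnectedOn_scc : StronglyConnectedOn G (scc G X v) := by
  have key : ∀ a b, a ∈ scc G X v → Relation.ReflTransGen (AdjAvoiding G X) a b →
      Relation.ReflTransGen (AdjAvoiding G X) b v →
      Relation.ReflTransGen (fun a b => a ∈ scc G X v ∧ b ∈ scc G X v ∧ G.Adj a b) a b := by
    intro a b ha hab
    induction hab with
    | refl => exact fun _ => .refl
    | @tail b c hab hbc ih =>
      intro hc
      have hb : b ∈ scc G X v := ⟨ha.1.trans hab, hc.head hbc⟩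
      exact (ih hb.2).tail ⟨hb, ⟨hb.1.tail hbc, hc⟩, hbc.2.2⟩
  exact fun a ha b hb => key a b ha (ha.2.trans hb.1) hb.2

theorem disjoint_scc (hv : v ∉ X) : Disjoint (scc G X v) X := by
  refine Set.disjoint_left.2 fun u hu => ?_
  rcases hu.1.cases_tail with h | ⟨b, -, h⟩
  · exact h ▸ hv
  · exact h.2.1

theorem isComponent_scc (hv : v ∉ X) : IsComponent G X (scc G X v) := by
  refine ⟨⟨⟨v, self_mem_scc⟩, disjoint_scc hv, stronglyConnectedOn_scc⟩, fun S hS hle => ?_⟩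
  exact hS.2.2.subset_scc hS.2.1 (hle self_mem_scc)

theorem IsComponent.eq_scc (hR : IsComponent G X R) (hv : v ∈ R) : R = scc G X v := by
  have h := hR.prop.2.2.subset_scc hR.prop.2.1 hv
  have hvX : v ∉ X := Set.disjoint_left.1 hR.prop.2.1 hv
  exact h.antisymm (hR.2 (isComponent_scc hvX).prop h)

theorem scc_mono (h : Y ⊆ X) : scc G X v ⊆ scc G Y v := by
  have key : ∀ a b, AdjAvoiding G X a b → AdjAvoiding G Y a b := fun a b hab =>
    ⟨fun ha => hab.1 (h ha), fun hb => hab.2.1 (h hb), hab.2.2⟩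
  exact fun u hu => ⟨Relation.ReflTransGen.mono key _ _ hu.1, Relation.ReflTransGen.mono key _ _ hu.2⟩

theorem scc_subset_scc (h : u ∈ scc G X v) : scc G X u ⊆ scc G X v :=
  fun _ hw => ⟨h.1.trans hw.1, hw.2.trans h.2⟩

/-- The robber may go to the component of any vertex he can reach and return from while the cops
move. -/
theorem robberMove_scc {C C' : Set V} (hR : IsComponent G C R) (hv : v ∈ R)
    (hu : u ∈ scc G (C ∩ C') v) (huC : u ∉ C') : RobberMove G C C' R (scc G C' u) := by
  refine ⟨isComponent_scc huC, scc G (C ∩ C') v, isComponent_scc fun h => ?_, ?_, ?_⟩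
  · exact Set.disjoint_left.1 hR.prop.2.1 hv h.1
  · rw [hR.eq_scc hv]
    exact scc_mono Set.inter_subset_left
  · exact (scc_mono Set.inter_subset_right).trans (scc_subset_scc hu)

theorem exists_robberChoice (legal : Set V → Prop) : ∃ R, RobberChoice legal R := by
  by_cases h : ∃ R, legal R
  · exact h.imp fun _ => Or.inl
  · exact ⟨∅, Or.inr ⟨rfl, fun S hS => h ⟨S, hS⟩⟩⟩

end Scc

/-! ### Plays, monotone strategies and winning by an invariant -/

section Play

variable {V : Type*} {G : Digraph V} {σ : Strategy V} {p q : ℕ → Pos V} {m : ℕ}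

theorem history_congr {i : ℕ} (h : ∀ j ≤ i, p j = q j) : history p i = history q i := by
  refine List.map_congr_left fun j hj => h j ?_
  have := List.mem_range.1 hj
  omega

theorem IsPlay.congr (hp : IsPlay G σ p m) (h : ∀ j ≤ m, p j = q j) : IsPlay G σ q m := by
  refine ⟨h 0 (Nat.zero_le _) ▸ hp.1, fun i hi => ?_⟩
  rw [← h i hi.le, ← h (i + 1) hi, ← history_congr fun j hj => h j (hj.trans hi.le)]
  exact hp.2 i hi

theorem IsPlay.of_le {k : ℕ} (hp : IsPlay G σ p m) (h : k ≤ m) : IsPlay G σ p k :=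
  ⟨hp.1, fun i hi => hp.2 i (hi.trans_le h)⟩

/-- A play is prolonged by one round. -/
theorem IsPlay.extend (hp : IsPlay G σ p m) (hne : (p m).robber.Nonempty) {R : Set V}
    (hR : RobberChoice (RobberMove G (p m).cops (σ (history p m)) (p m).robber) R) :
    ∃ q, (∀ j ≤ m, q j = p j) ∧ q (m + 1) = ⟨σ (history p m), R⟩ ∧ IsPlay G σ q (m + 1) := by
  let q := Function.update p (m + 1) ⟨σ (history p m), R⟩
  have hq : ∀ j ≤ m, q j = p j := fun j hj => Function.update_of_ne (by omega) _ _
  have hlast : q (m + 1) = ⟨σ (history p m), R⟩ := Function.update_self _ _ _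
  have hqm : IsPlay G σ q m := hp.congr fun j hj => (hq j hj).symm
  refine ⟨q, hq, hlast, hqm.1, fun i hi => ?_⟩
  rcases Nat.lt_succ_iff_lt_or_eq.1 hi with h | rfl
  · exact hqm.2 i h
  · rw [hlast, hq i le_rfl, history_congr hq]
    exact ⟨rfl, hne, hR⟩

theorem IsPlay.isComponent (hp : IsPlay G σ p m) (hne : (p m).robber.Nonempty) :
    IsComponent G (p m).cops (p m).robber := by
  cases m with
  | zero =>
    rcases hp.1.2 with h | h
    · rw [hp.1.1]
      exact h
    · exact absurd h.1 hne.ne_empty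
  | succ m =>
    rcases (hp.2 m (Nat.lt_succ_self m)).2.2 with h | h
    · exact h.1
    · exact absurd h.1 hne.ne_empty

/-- If every play with the property `P` can be prolonged to one with the property `P`, then there
is an infinite play. -/
theorem exists_infinite_play (P : (ℕ → Pos V) → ℕ → Prop) (hP : ∀ p m, P p m → IsPlay G σ p m)
    (hext : ∀ p m, P p m → ∃ q, (∀ j ≤ m, q j = p j) ∧ P q (m + 1)) (h0 : P p m) :
    ∃ q, ∀ k, IsPlay G σ q k := by
  choose! F hF using hext
  -- Stage `t` settles the positions up to `m + t`, so the diagonal `f j j` is the limit play.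
  let f : ℕ → ℕ → Pos V := fun t => Nat.rec p (fun t r => F r (m + t)) t
  have hf : ∀ t, P (f t) (m + t) := by
    intro t
    induction t with
    | zero => exact h0
    | succ t ih => exact (hF _ _ ih).2
  have hstep : ∀ t j, j ≤ m + t → f (t + 1) j = f t j := fun t j hj => (hF _ _ (hf t)).1 j hj
  have hagree : ∀ j s, f (j + s) j = f j j := by
    intro j s
    induction s with
    | zero => rfl
    | succ s ih => rw [← ih, ← hstep (j + s) j (by omega)]; rfl
  refine ⟨fun j => f j j, fun k => ?_⟩
  refine ((hP _ _ (hf k)).of_le (Nat.le_add_left k m)).congr fun j hj => ?_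
  obtain ⟨s, rfl⟩ := Nat.exists_eq_add_of_le hj
  exact hagree j s

/-- In every play against a winning cop strategy there is a last moment at which `P` holds. -/
theorem IsWinning.exists_last {Mon : (ℕ → Pos V) → ℕ → Prop} {k : ℕ} (hσ : IsWinning G Mon k σ)
    (P : (ℕ → Pos V) → ℕ → Prop) (hP : ∀ p m, P p m → IsPlay G σ p m) (h0 : P p m) :
    ∃ p m, P p m ∧ ∀ q, (∀ j ≤ m, q j = p j) → ¬ P q (m + 1) := by
  by_contra! h
  exact hσ.2.1 (exists_infinite_play P hP h h0)

/-- Consistent plays are cop-monotone also before the robber is captured. -/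
theorem IsWinning.copMonotone {k : ℕ} (hσ : IsWinning G CopMonotone k σ) (hp : IsPlay G σ p m) :
    CopMonotone p m := by
  by_contra hmon
  -- A violation survives every prolongation and excludes a capture, so it would lead to an infinite
  -- play.
  obtain ⟨p, m, ⟨hp, hmon⟩, hlast⟩ := hσ.exists_last
    (fun p m => IsPlay G σ p m ∧ ¬ CopMonotone p m) (fun _ _ h => h.1) ⟨hp, hmon⟩
  rcases Set.eq_empty_or_nonempty (p m).robber with he | hne
  · exact hmon (hσ.2.2 p m hp he)
  obtain ⟨R, hR⟩ := exists_robberChoice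
    (RobberMove G (p m).cops (σ (history p m)) (p m).robber)
  obtain ⟨q, hq, -, hqp⟩ := hp.extend hne hR
  refine hlast q hq ⟨hqp, fun h => hmon fun i j k hij hjk hk => ?_⟩
  rw [← hq i (by omega), ← hq j (by omega), ← hq k hk]
  exact h i j k hij hjk (by omega)

/-- The cops never return to a vertex they have left. -/
theorem IsWinning.notMem_next {k : ℕ} (hσ : IsWinning G CopMonotone k σ) (hp : IsPlay G σ p m)
    (hne : (p m).robber.Nonempty) {j : ℕ} (hj : j ≤ m) {x : V} (hx : x ∈ (p j).cops)
    (hxm : x ∉ (p m).cops) : x ∉ σ (history p m) := by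
  intro hxn
  obtain ⟨R, hR⟩ := exists_robberChoice
    (RobberMove G (p m).cops (σ (history p m)) (p m).robber)
  obtain ⟨q, hq, hlast, hqp⟩ := hp.extend hne hR
  have hjm : j < m := lt_of_le_of_ne hj fun h => hxm (h ▸ hx)
  have := hσ.copMonotone hqp j m (m + 1) hjm (Nat.lt_succ_self m) le_rfl
  rw [hq j hj, hq m le_rfl, hlast] at this
  exact hxm (this ⟨hx, hxn⟩)

/-- Against a cop-monotone winning strategy, no vertex left by the cops gets into the robber
component. -/
theorem IsWinning.notMem_robber {k : ℕ} (hσ : IsWinning G CopMonotone k σ) (hp : IsPlay G σ p m)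
    {j : ℕ} (hj : j ≤ m) {x : V} (hx : x ∈ (p j).cops) : x ∉ (p m).robber := by
  intro hxR
  obtain ⟨p, m, ⟨hp, hxR, j, hj, hx⟩, hlast⟩ := hσ.exists_last
    (fun p m => IsPlay G σ p m ∧ x ∈ (p m).robber ∧ ∃ j ≤ m, x ∈ (p j).cops)
    (fun _ _ h => h.1) ⟨hp, hxR, j, hj, hx⟩
  have hR := hp.isComponent ⟨x, hxR⟩
  have hxC : x ∉ (p m).cops := Set.disjoint_left.1 hR.prop.2.1 hxR
  -- Since the cops may not return to `x`, the robber can stay with `x` for another round, and so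
  -- for ever.
  have hxn := hσ.notMem_next hp ⟨x, hxR⟩ hj hx hxC
  obtain ⟨q, hq, hqm, hqp⟩ := hp.extend ⟨x, hxR⟩ (Or.inl (robberMove_scc hR hxR self_mem_scc hxn))
  refine hlast q hq ⟨hqp, ?_, j, by omega, ?_⟩
  · rw [hqm]
    exact self_mem_scc
  · rw [hq j hj]
    exact hx

/-- Some play consistent with `σ` ends with the cops on `C` and `v` in the robber component, and
`U` is the set of vertices that have been occupied by cops. -/
def Reachable (G : Digraph V) (σ : Strategy V) (U C : Set V) (v : V) : Prop :=
  ∃ p m, IsPlay G σ p m ∧ (p m).cops = C ∧ v ∈ (p m).robber ∧ U = {x | ∃ j ≤ m, x ∈ (p j).cops}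

theorem reachable_start (G : Digraph V) (σ : Strategy V) (v : V) :
    Reachable G σ ∅ ∅ v := by
  refine ⟨fun _ => ⟨∅, scc G ∅ v⟩, 0,
    ⟨⟨rfl, Or.inl (isComponent_scc (Set.notMem_empty v))⟩, fun i hi => absurd hi (by omega)⟩, rfl,
    self_mem_scc, ?_⟩
  simp

theorem Reachable.notMem_scc {k : ℕ} (hσ : IsWinning G CopMonotone k σ) {U C : Set V} {v x : V}
    (h : Reachable G σ U C v) (hx : x ∈ U) : x ∉ scc G C v := by
  obtain ⟨p, m, hp, rfl, hv, rfl⟩ := h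
  obtain ⟨j, hj, hxj⟩ := hx
  rw [← (hp.isComponent ⟨v, hv⟩).eq_scc hv]
  exact hσ.notMem_robber hp hj hxj

/-- The robber waits at `v` until the cops come to `v`, and then goes to a neighbour of `v`. -/
theorem Reachable.step {k : ℕ} (hσ : IsWinning G CopMonotone k σ) {U C : Set V} {v : V}
    (h : Reachable G σ U C v) :
    ∃ U' C', U ⊆ U' ∧ C' ⊆ U' ∧ Disjoint C' (U \ C) ∧ v ∈ C' ∧ C'.encard ≤ k ∧
      ∀ c, G.Adj v c → G.Adj c v → c ∉ C' → Reachable G σ U' C' c := by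
  obtain ⟨p₀, m₀, hp₀, rfl, hv₀, rfl⟩ := h
  obtain ⟨p, m, ⟨hp, hv, hm, hagree⟩, hlast⟩ := hσ.exists_last
    (fun p m => IsPlay G σ p m ∧ v ∈ (p m).robber ∧ m₀ ≤ m ∧ ∀ j ≤ m₀, p j = p₀ j)
    (fun _ _ h => h.1) ⟨hp₀, hv₀, le_rfl, fun _ _ => rfl⟩
  have hR := hp.isComponent ⟨v, hv⟩
  have hvC : v ∉ (p m).cops := Set.disjoint_left.1 hR.prop.2.1 hv
  -- Otherwise staying with `v` would contradict the choice of the last moment.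
  have hvn : v ∈ σ (history p m) := by
    by_contra hvn
    obtain ⟨q, hq, hqm, hqp⟩ := hp.extend ⟨v, hv⟩ (Or.inl (robberMove_scc hR hv self_mem_scc hvn))
    refine hlast q hq ⟨hqp, ?_, by omega, fun j hj => ?_⟩
    · rw [hqm]
      exact self_mem_scc
    · rw [hq j (by omega), hagree j hj]
  have hused : ∀ q : ℕ → Pos V, (∀ j ≤ m, q j = p j) → (q (m + 1)).cops = σ (history p m) →
      {x | ∃ j ≤ m + 1, x ∈ (q j).cops} =
        {x | ∃ j ≤ m, x ∈ (p j).cops} ∪ σ (history p m) := by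
    intro q hq hqm
    ext x
    constructor
    · rintro ⟨j, hj, hx⟩
      rcases Nat.le_succ_iff.1 hj with h | rfl
      · exact Or.inl ⟨j, h, hq j h ▸ hx⟩
      · exact Or.inr (hqm ▸ hx)
    · rintro (⟨j, hj, hx⟩ | hx)
      · exact ⟨j, by omega, (hq j hj).symm ▸ hx⟩
      · exact ⟨m + 1, le_rfl, hqm.symm ▸ hx⟩
  refine ⟨{x | ∃ j ≤ m, x ∈ (p j).cops} ∪ σ (history p m), σ (history p m), ?_,
    Set.subset_union_right, ?_, hvn, ?_, ?_⟩
  · rintro x ⟨j, hj, hx⟩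
    exact Or.inl ⟨j, hj.trans hm, (hagree j hj).symm ▸ hx⟩
  · refine Set.disjoint_right.2 ?_
    rintro x ⟨⟨j, hj, hx⟩, hxC⟩
    rw [← hagree j hj] at hx
    rw [← hagree m₀ le_rfl] at hxC
    -- A vertex left by time `m₀` is still free at time `m`, by monotonicity for `j < m₀ < m`.
    refine hσ.notMem_next hp ⟨v, hv⟩ (hj.trans hm) hx fun hxm => hxC ?_
    have hjm₀ : j < m₀ := lt_of_le_of_ne hj fun h => hxC (h ▸ hx)
    rcases hm.eq_or_lt with rfl | hlt
    · exact hxm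
    · exact hσ.copMonotone hp j m₀ m hjm₀ hlt le_rfl ⟨hx, hxm⟩
  · obtain ⟨R, hR⟩ := exists_robberChoice
      (RobberMove G (p m).cops (σ (history p m)) (p m).robber)
    obtain ⟨q, -, hqm, hqp⟩ := hp.extend ⟨v, hv⟩ hR
    have := hσ.1 q (m + 1) hqp (m + 1) le_rfl
    rwa [hqm] at this
  · intro c hvc hcv hc
    have hvI : v ∉ (p m).cops ∩ σ (history p m) := fun h => hvC h.1
    have hcI : c ∉ (p m).cops ∩ σ (history p m) := fun h => hc h.2
    have hmem : c ∈ scc G ((p m).cops ∩ σ (history p m)) v :=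
      ⟨.single ⟨hvI, hcI, hvc⟩, .single ⟨hcI, hvI, hcv⟩⟩
    obtain ⟨q, hq, hqm, hqp⟩ := hp.extend ⟨v, hv⟩ (Or.inl (robberMove_scc hR hv hmem hc))
    refine ⟨q, m + 1, hqp, ?_, ?_, (hused q hq ?_).symm⟩
    · rw [hqm]
    · rw [hqm]
      exact self_mem_scc
    · rw [hqm]

/-- A cop strategy that depends on the number of the round and on a vertex of the robber component
wins within `N` rounds, if it preserves an invariant that cannot hold after round `N`. -/
theorem exists_isWinning_of_invariant {k N : ℕ} (next : ℕ → V → Set V)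
    (Inv : ℕ → Set V → Set V → Prop)
    (hbound : ∀ i v, (next i v).encard ≤ k)
    (hstart : ∀ R, R.Nonempty → IsComponent G ∅ R → Inv 0 ∅ R)
    (hstep : ∀ i C R R' v, Inv i C R → v ∈ R → RobberMove G C (next i v) R R' →
      Inv (i + 1) (next i v) R')
    (hend : ∀ i C R, R.Nonempty → Inv i C R → i < N) :
    ∃ σ, IsWinning G (fun _ _ => True) k σ := by
  classical
  -- The history before round `i + 1` has `i + 1` entries, hence `l.length - 1`. The value `∅` is
  -- taken only when the last robber set is empty or the history is.
  let σ : Strategy V := fun l =>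
    if h : ∃ v, ∃ s ∈ l.getLast?, v ∈ s.robber then next (l.length - 1) h.choose else ∅
  have hlast : ∀ (p : ℕ → Pos V) i, (history p i).getLast? = some (p i) := by
    intro p i
    simp [history, List.range_succ]
  have hσ : ∀ (p : ℕ → Pos V) i, (p i).robber.Nonempty →
      ∃ v ∈ (p i).robber, σ (history p i) = next i v := by
    intro p i hne
    have hex : ∃ v, ∃ s ∈ (history p i).getLast?, v ∈ s.robber := by
      obtain ⟨v, hv⟩ := hne
      exact ⟨v, p i, by simp [hlast], hv⟩
    refine ⟨hex.choose, ?_, ?_⟩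
    · obtain ⟨s, hs, hv⟩ := hex.choose_spec
      rw [hlast, Option.mem_def, Option.some_inj] at hs
      exact hs ▸ hv
    · simp only [σ]
      rw [dif_pos hex]
      simp [history]
  have hInv : ∀ p m, IsPlay G σ p m → (p m).robber.Nonempty →
      Inv m (p m).cops (p m).robber := by
    intro p m
    induction m with
    | zero =>
      intro hp hne
      have := hp.isComponent hne
      rw [hp.1.1] at this ⊢
      exact hstart _ hne this
    | succ m ih =>
      intro hp hne
      obtain ⟨h1, h2, h3⟩ := hp.2 m (Nat.lt_succ_self m)
      obtain ⟨v, hv, hvσ⟩ := hσ p m h2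
      rw [hvσ] at h1
      rcases h3 with h3 | h3
      · rw [h1] at h3 ⊢
        exact hstep m _ _ _ v (ih (hp.of_le (Nat.le_succ m)) h2) hv h3
      · exact absurd h3.1 hne.ne_empty
  refine ⟨σ, ?_, ?_, fun _ _ _ _ => trivial⟩
  · intro p m hp i hi
    cases i with
    | zero =>
      rw [hp.1.1]
      simp
    | succ i =>
      obtain ⟨h1, h2, -⟩ := hp.2 i hi
      obtain ⟨v, -, hvσ⟩ := hσ p i h2
      rw [h1, hvσ]
      exact hbound i v
  · rintro ⟨p, hp⟩
    have hne := ((hp (N + 1)).2 N (Nat.lt_succ_self N)).2.1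
    exact absurd (hend N _ _ hne (hInv p N (hp N) hne)) (lt_irrefl N)

end Play

/-! ### The guarded tree and its separators -/

/-- The largest depth of a vertex of the tree. -/
def height (n : ℕ) : ℕ := n * (2 * n + 1)

/-- A child of a vertex in the tree is given by the number of a copy, a direction and a set of
depths. -/
abbrev Label (n : ℕ) := Fin n × Bool × (Finset.range (height n)).powerset

/-- The direction in which the subtree of a child is guarded by some of its ancestors. -/
def Label.dir {n : ℕ} (x : Label n) : Bool := x.2.1

/-- The depths of the ancestors that guard the subtree of a child. -/
def Label.depths {n : ℕ} (x : Label n) : Finset ℕ := x.2.2.1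

/-- The depths of the ancestors of a tree vertex that guard its subtree. -/
def guard {n : ℕ} : List (Label n) → Finset ℕ
  | [] => ∅
  | x :: _ => x.depths

/-- The lists that are vertices of the tree. The tail of a list is its parent. -/
def Valid {n : ℕ} : List (Label n) → Prop
  | [] => True
  | x :: w => w.length < height n ∧ x.depths.card ≤ 2 ∧ (x.depths ∪ guard w).card ≤ 3 ∧ Valid w

/-- `a` is a proper ancestor of `b`, and it belongs to the guard of every vertex of direction `d`
on the path from `a` (excluded) to `b`. -/
def Allowed {n : ℕ} (d : Bool) (a : List (Label n)) : List (Label n) → Prop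
  | [] => False
  | x :: w => (x.dir = d → a.length ∈ x.depths) ∧ (a = w ∨ Allowed d a w)

/-- The vertices of the tree. -/
abbrev Vert (n : ℕ) := {l : List (Label n) // Valid l}

/-- The tree with edges in both directions, together with all further arcs between ancestors and
descendants that respect the guards: those of direction `true` constrain the arcs that enter a
subtree, those of direction `false` the arcs that leave it. -/
def guardedTree (n : ℕ) : Digraph (Vert n) where
  Adj a b := (∃ x, b.1 = x :: a.1) ∨ (∃ x, a.1 = x :: b.1) ∨ Allowed true a.1 b.1 ∨
    Allowed false b.1 a.1

section Tree

variable {n : ℕ} {d : Bool} {a b w v : List (Label n)} {x y : Label n}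

theorem Valid.length_le (h : Valid a) : a.length ≤ height n := by
  cases a with
  | nil => exact Nat.zero_le _
  | cons x w => exact h.1

theorem Valid.card_guard_le (h : Valid a) : (guard a).card ≤ 2 := by
  cases a with
  | nil => exact Nat.zero_le _
  | cons x w => exact h.2.1

theorem Valid.of_suffix (h : Valid b) (hab : a <:+ b) : Valid a := by
  induction b with
  | nil => rwa [List.suffix_nil.1 hab]
  | cons x w ih =>
    rcases List.suffix_cons_iff.1 hab with rfl | hab
    · exact h
    · exact ih h.2.2.2 hab

theorem Allowed.suffix (h : Allowed d a b) : a <:+ b ∧ a.length < b.length := by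
  induction b with
  | nil => exact h.elim
  | cons x w ih =>
    rcases h.2 with rfl | h
    · exact ⟨List.suffix_cons _ _, by simp⟩
    · exact ⟨(ih h).1.trans (List.suffix_cons _ _), (ih h).2.trans (by simp)⟩

theorem Allowed.mem_depths (h : Allowed d a b) (hxb : x :: w <:+ b) (haw : a <:+ w)
    (hx : x.dir = d) : a.length ∈ x.depths := by
  induction b with
  | nil => exact h.elim
  | cons z b ih =>
    rcases List.suffix_cons_iff.1 hxb with heq | hxb
    · rw [List.cons.injEq] at heq
      exact heq.1 ▸ h.1 (heq.1 ▸ hx)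
    · rcases h.2 with rfl | h
      · have h1 := hxb.length_le
        have h2 := haw.length_le
        simp only [List.length_cons] at h1
        omega
      · exact ih h hxb

instance : Finite (Vert n) := by
  have : Finite {l : List (Label n) | l.length ≤ height n} := List.finite_length_le _ _
  exact Finite.of_injective (β := {l : List (Label n) | l.length ≤ height n})
    (fun l => ⟨l.1, l.2.length_le⟩) fun a b h => Subtype.ext (by simpa using h)

theorem guardedTree_irrefl (v : Vert n) : ¬ (guardedTree n).Adj v v := by
  rintro (⟨x, h⟩ | ⟨x, h⟩ | h | h)
  · simpa using congrArg List.length h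
  · simpa using congrArg List.length h
  · exact lt_irrefl _ h.suffix.2
  · exact lt_irrefl _ h.suffix.2

theorem reflTransGen_closed {α : Type*} {r : α → α → Prop} {p : α → Prop} {a b : α}
    (h : Relation.ReflTransGen r a b) (hr : ∀ a b, r a b → p a → p b) (ha : p a) : p b := by
  induction h with
  | refl => exact ha
  | tail _ hbc ih => exact hr _ _ hbc ih

/-- The ancestors of `v` in the guard of `v`, or those in the guard of its child `c`, together with
`v` separate the subtree of `c` from the rest of the graph. -/
theorem subtree_of_stronglyConnectedOn {z : List (Label n)} (hz : z = v ∨ z = y :: v)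
    {S : Set (Vert n)} (hS : StronglyConnectedOn (guardedTree n) S)
    (hd : ∀ a ∈ S, a.1 <:+ v → a.1 ≠ v ∧ a.1.length ∉ guard z) {r : Vert n} (hr : r ∈ S)
    (hrc : y :: v <:+ r.1) : ∀ s ∈ S, y :: v <:+ s.1 := by
  have key : ∃ d, ∀ a ∈ S, ∀ b ∈ S, y :: v <:+ b.1 → ¬ y :: v <:+ a.1 →
      ¬ Allowed d a.1 b.1 := by
    have hav : ∀ a b : Vert n, ∀ d, y :: v <:+ b.1 → ¬ y :: v <:+ a.1 → Allowed d a.1 b.1 →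
        a.1 <:+ v := by
      intro a b d hb ha hall
      rcases List.suffix_or_suffix_of_suffix hall.suffix.1 hb with h | h
      · rcases List.suffix_cons_iff.1 h with h | h
        · exact absurd (h ▸ List.suffix_rfl) ha
        · exact h
      · exact absurd h ha
    rcases z with _ | ⟨x, w⟩
    -- At the root there is no guard: `v` is its only ancestor, and it is excluded, so either
    -- direction would do.
    · refine ⟨true, fun a ha b hb hbc hac hall => ?_⟩
      have h := hav a b true hbc hac hall
      have hv : v = [] := hz.elim Eq.symm fun h => by cases h
      exact (hd a ha h).1 (by rw [hv] at h ⊢; exact List.suffix_nil.1 h)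
    · refine ⟨x.dir, fun a ha b hb hbc hac hall => ?_⟩
      have h := hav a b _ hbc hac hall
      refine (hd a ha h).2 (hall.mem_depths (w := w) ?_ ?_ rfl)
      · rcases hz with hz | hz
        · rw [hz]
          exact (List.suffix_cons _ _).trans hbc
        · rwa [hz]
      · rcases hz with hz | hz
        · rw [← hz] at h
          rcases List.suffix_cons_iff.1 h with h' | h'
          · exact absurd (h'.trans hz) (hd a ha (hz ▸ h)).1
          · exact h'
        · rw [List.cons.injEq] at hz
          exact hz.2 ▸ h
  have hchild : ∀ a ∈ S, ∀ b : Vert n, y :: v <:+ b.1 → ¬ y :: v <:+ a.1 →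
      ¬ ∃ x, b.1 = x :: a.1 := by
    rintro a ha b hb hac ⟨x, h⟩
    rw [h] at hb
    rcases List.suffix_cons_iff.1 hb with h | h
    · rw [List.cons.injEq] at h
      exact (hd a ha (h.2 ▸ List.suffix_rfl)).1 h.2.symm
    · exact hac h
  have hparent : ∀ a b : Vert n, y :: v <:+ b.1 → ¬ y :: v <:+ a.1 → ¬ ∃ x, a.1 = x :: b.1 := by
    rintro a b hb hac ⟨x, h⟩
    exact hac (h ▸ hb.trans (List.suffix_cons _ _))
  intro s hs
  obtain ⟨d, hd'⟩ := key
  cases d with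
  | true =>
    by_contra hsc
    refine reflTransGen_closed (p := fun a => ¬ y :: v <:+ a.1) (hS s hs r hr) ?_ hsc hrc
    rintro a b ⟨ha, hb, hab⟩ hac hbc
    rcases hab with h | h | h | h
    · exact hchild a ha b hbc hac h
    · exact hparent a b hbc hac h
    · exact hd' a ha b hb hbc hac h
    · exact hac (hbc.trans h.suffix.1)
  | false =>
    refine reflTransGen_closed (p := fun a => y :: v <:+ a.1) (hS r hr s hs) ?_ hrc
    rintro b a ⟨hb, ha, hab⟩ hbc
    by_contra hac
    rcases hab with h | h | h | h
    · exact hparent a b hbc hac h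
    · exact hchild a ha b hbc hac h
    · exact hac (hbc.trans h.suffix.1)
    · exact hd' a ha b hb hbc hac h

/-- The suffixes of `l` whose depth is in `F`. -/
def suffixesAt (l : List (Label n)) (F : Finset ℕ) : Set (Vert n) :=
  {a | a.1 <:+ l ∧ a.1.length ∈ F}

theorem encard_suffixesAt_le (l : List (Label n)) (F : Finset ℕ) :
    (suffixesAt l F).encard ≤ F.card := by
  have hinj : Set.InjOn (fun a : Vert n => a.1.length) (suffixesAt l F) := by
    intro a ha b hb hab
    exact Subtype.ext ((List.suffix_of_suffix_length_le ha.1 hb.1 hab.le).eq_of_length hab)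
  rw [← hinj.encard_image, ← Set.encard_coe_eq_coe_finsetCard]
  refine Set.encard_le_encard ?_
  rintro _ ⟨a, ha, rfl⟩
  exact ha.2

/-- The ancestor of depth `k` (including the vertex itself). -/
def ancestor (k : ℕ) (l : List (Label n)) : List (Label n) := l.drop (l.length - k)

theorem ancestor_suffix (k : ℕ) (l : List (Label n)) : ancestor k l <:+ l := List.drop_suffix _ _

theorem ancestor_eq {k : ℕ} (h : a <:+ b) (hk : a.length = k) : ancestor k b = a := by
  have hl := h.length_le
  refine (List.suffix_of_suffix_length_le (ancestor_suffix k b) h ?_).eq_of_length ?_ <;>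
    simp only [ancestor, List.length_drop] <;> omega

theorem exists_cons_suffix (h : a <:+ b) (hne : a ≠ b) : ∃ x, x :: a <:+ b := by
  induction b with
  | nil => exact absurd (List.suffix_nil.1 h) hne
  | cons z b ih =>
    rcases List.suffix_cons_iff.1 h with h | h
    · exact absurd h hne
    · by_cases hab : a = b
      · exact ⟨z, hab ▸ List.suffix_rfl⟩
      · exact (ih h hab).imp fun x hx => hx.trans (List.suffix_cons z b)

end Tree

/-! ### Four cops win -/

section Upper

variable {n : ℕ}

/-- The cops chase the robber down the tree: they occupy the vertex `v` of depth `k` above him, and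
then they replace the guard of `v` by the guard of the child he has chosen. -/
def chase (n i : ℕ) (r : Vert n) : Set (Vert n) :=
  if i % 2 = 0 then
    suffixesAt r.1 (guard (ancestor (i / 2) r.1) ∪ {i / 2, i / 2 - 1})
  else
    suffixesAt r.1 (guard (ancestor (i / 2 + 1) r.1) ∪
      guard (ancestor (i / 2 + 1) r.1).tail ∪ {i / 2})

/-- Even rounds cost two for a guard and two for `v` and its parent; odd rounds cost three for two
consecutive guards and one for `v`. The bounds in `Valid` are made for this count. -/
theorem encard_chase_le (i : ℕ) (r : Vert n) : (chase n i r).encard ≤ 4 := by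
  unfold chase
  split_ifs
  · refine (encard_suffixesAt_le _ _).trans ?_
    have h1 := (r.2.of_suffix (ancestor_suffix (i / 2) r.1)).card_guard_le
    have h2 := Finset.card_union_le (guard (ancestor (i / 2) r.1)) {i / 2, i / 2 - 1}
    have h3 : ({i / 2, i / 2 - 1} : Finset ℕ).card ≤ 2 := Finset.card_le_two
    exact_mod_cast (by omega : _ ≤ 4)
  · refine (encard_suffixesAt_le _ _).trans ?_
    have h1 : (guard (ancestor (i / 2 + 1) r.1) ∪
        guard (ancestor (i / 2 + 1) r.1).tail).card ≤ 3 := by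
      have := r.2.of_suffix (ancestor_suffix (i / 2 + 1) r.1)
      generalize ancestor (i / 2 + 1) r.1 = l at this ⊢
      rcases l with _ | ⟨x, w⟩
      · simp [guard]
      · exact this.2.2.1
    have h2 := Finset.card_union_le (guard (ancestor (i / 2 + 1) r.1) ∪
      guard (ancestor (i / 2 + 1) r.1).tail) {i / 2}
    rw [Finset.card_singleton] at h2
    exact_mod_cast (by omega : _ ≤ 4)

/-- The situation before round `i + 1` when the cops play `chase`. -/
def ChaseInv (n i : ℕ) (C R : Set (Vert n)) : Prop :=
  if i % 2 = 0 then
    ∃ v : List (Label n), v.length = i / 2 ∧ (∀ r ∈ R, v <:+ r.1) ∧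
      ∀ x w, v = x :: w → suffixesAt w (x.depths ∪ {w.length}) ⊆ C
  else
    ∃ (v : List (Label n)) (y : Label n), v.length = i / 2 ∧ (∀ r ∈ R, y :: v <:+ r.1) ∧
      suffixesAt v (guard v ∪ {v.length}) ⊆ C

/-- An arc between a proper ancestor of `v` and the subtree of `y :: v` also crosses the border of
the subtree of `v`. With `v` occupied, the guard of `v` therefore serves as well as that of the
child. -/
theorem subtree_of_isComponent {v z : List (Label n)} {y : Label n} (hz : z = v ∨ z = y :: v)
    {C K : Set (Vert n)} (hK : IsComponent (guardedTree n) C K)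
    (hC : suffixesAt v (guard z ∪ {v.length}) ⊆ C) {r : Vert n} (hr : r ∈ K)
    (hrc : y :: v <:+ r.1) : ∀ s ∈ K, y :: v <:+ s.1 := by
  refine subtree_of_stronglyConnectedOn hz hK.prop.2.2 (fun a ha hav => ?_) hr hrc
  have haC := Set.disjoint_left.1 hK.prop.2.1 ha
  refine ⟨fun h => haC (hC ⟨hav, ?_⟩), fun h => haC (hC ⟨hav, Finset.mem_union_left _ h⟩)⟩
  rw [h]
  exact Finset.mem_union_right _ (Finset.mem_singleton_self _)

/-- The cops that stay in place hold the robber during the move: in even rounds those on the guard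
of `v` and on its parent, in odd rounds those on the guard of `v` and on `v`. -/
theorem ChaseInv.step {i : ℕ} {C R R' : Set (Vert n)} {r : Vert n} (h : ChaseInv n i C R)
    (hr : r ∈ R) (hR : RobberMove (guardedTree n) C (chase n i r) R R') :
    ChaseInv n (i + 1) (chase n i r) R' := by
  obtain ⟨hR', K, hK, hRK, hR'K⟩ := hR
  unfold ChaseInv at h ⊢
  unfold chase at hK hR' ⊢
  by_cases hi : i % 2 = 0
  · have hi' : ¬ (i + 1) % 2 = 0 := by omega
    rw [if_pos hi] at h hK hR' ⊢
    rw [if_neg hi']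
    obtain ⟨v, hv, hvR, hC⟩ := h
    rw [ancestor_eq (hvR r hr) hv, ← hv] at hK hR' ⊢
    have hsub : suffixesAt v (guard v ∪ {v.length}) ⊆
        suffixesAt r.1 (guard v ∪ {v.length, v.length - 1}) := by
      rintro a ⟨hav, ha⟩
      refine ⟨hav.trans (hvR r hr), ?_⟩
      simp only [Finset.mem_union, Finset.mem_insert, Finset.mem_singleton] at ha ⊢
      tauto
    have hKv : ∀ s ∈ K, v <:+ s.1 := by
      rcases v with _ | ⟨x, w⟩
      · exact fun s _ => List.nil_suffix
      · refine subtree_of_isComponent (Or.inr rfl) hK ?_ (hRK hr) (hvR r hr)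
        refine fun a ha => ⟨hC x w rfl ha, ?_, ?_⟩
        · exact (ha.1.trans (List.suffix_cons _ _)).trans (hvR r hr)
        · have := ha.2
          simp only [guard, Finset.mem_union, Finset.mem_insert, Finset.mem_singleton,
            List.length_cons, Nat.add_sub_cancel] at this ⊢
          tauto
    obtain ⟨s, hs⟩ := hR'.prop.1
    have hvs := hKv s (hR'K hs)
    have hne : v ≠ s.1 := by
      rintro rfl
      refine Set.disjoint_left.1 hR'.prop.2.1 hs (hsub ⟨List.suffix_rfl, ?_⟩)
      exact Finset.mem_union_right _ (Finset.mem_singleton_self _)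
    obtain ⟨y, hys⟩ := exists_cons_suffix hvs hne
    exact ⟨v, y, by omega, subtree_of_isComponent (Or.inl rfl) hR' hsub hs hys, hsub⟩
  · have hi' : (i + 1) % 2 = 0 := by omega
    rw [if_neg hi] at h hK hR' ⊢
    rw [if_pos hi']
    obtain ⟨v, y, hv, hvR, hC⟩ := h
    have hlen : (y :: v).length = i / 2 + 1 := by rw [List.length_cons, hv]
    rw [ancestor_eq (hvR r hr) hlen, ← hv, List.tail_cons] at hK hR' ⊢
    have hvr : v <:+ r.1 := (List.suffix_cons _ _).trans (hvR r hr)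
    refine ⟨y :: v, by omega, ?_, ?_⟩
    · refine fun s hs => subtree_of_isComponent (Or.inl rfl) hK ?_ (hRK hr) (hvR r hr) s (hR'K hs)
      refine fun a ha => ⟨hC ha, ha.1.trans hvr, ?_⟩
      have := ha.2
      simp only [Finset.mem_union, Finset.mem_singleton] at this ⊢
      tauto
    · intro x w hxw
      rw [List.cons.injEq] at hxw
      obtain ⟨rfl, rfl⟩ := hxw
      refine fun a ha => ⟨ha.1.trans hvr, ?_⟩
      have := ha.2
      simp only [guard, Finset.mem_union, Finset.mem_singleton] at this ⊢
      tauto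

theorem dtwCops_guardedTree_le (n : ℕ) : dtwCops (guardedTree n) ≤ 4 := by
  -- Before round `i + 1` the robber is at depth at least `i / 2`, which is at most `height n`.
  refine Nat.sInf_le (exists_isWinning_of_invariant (N := 2 * height n + 2) (chase n) (ChaseInv n)
    encard_chase_le ?_ (fun i C R R' r h hr hR => h.step hr hR) ?_)
  · intro R _ _
    refine ⟨[], rfl, fun r _ => List.nil_suffix, fun x w h => ?_⟩
    cases h
  · rintro i C R ⟨r, hr⟩ h
    have hr' := r.2.length_le
    unfold ChaseInv at h
    split_ifs at h
    · obtain ⟨v, hv, hvR, -⟩ := h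
      have := (hvR r hr).length_le
      omega
    · obtain ⟨v, y, hv, hvR, -⟩ := h
      have := (hvR r hr).length_le
      rw [List.length_cons] at this
      omega

end Upper

/-! ### Cop-monotone strategies need `n` cops -/

section Lower

variable {n k : ℕ} {σ : Strategy (Vert n)}

/-- `c` is a child of `v` with guard depths `F` of direction `d`. -/
def IsChild (d : Bool) (F : Finset ℕ) (v c : Vert n) : Prop :=
  ∃ x : Label n, c.1 = x :: v.1 ∧ x.dir = d ∧ x.depths = F

theorem IsChild.length {d : Bool} {F : Finset ℕ} {v c : Vert n} (h : IsChild d F v c) :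
    c.1.length = v.1.length + 1 := by
  obtain ⟨x, hx, -, -⟩ := h
  rw [hx, List.length_cons]

theorem IsChild.guard_eq {d : Bool} {F : Finset ℕ} {v c : Vert n} (h : IsChild d F v c) :
    guard c.1 = F := by
  obtain ⟨x, hx, -, rfl⟩ := h
  rw [hx]
  rfl

/-- Only a child of direction `e` restricts the arcs of direction `e`; one of the other direction
inherits them all. -/
theorem IsChild.allowed {d e : Bool} {F : Finset ℕ} {v c a : Vert n} (h : IsChild d F v c)
    (ha : a = v ∨ Allowed e a.1 v.1) (hF : d = e → a.1.length ∈ F) : Allowed e a.1 c.1 := by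
  obtain ⟨x, hx, rfl, rfl⟩ := h
  rw [hx]
  exact ⟨hF, ha.imp_left (congrArg Subtype.val)⟩

theorem guard_subset (l : List (Label n)) : guard l ⊆ Finset.range (height n) := by
  cases l with
  | nil => exact Finset.empty_subset _
  | cons x w => exact Finset.mem_powerset.1 x.2.2.2

/-- Fewer than `n` vertices do not include all children of a vertex with a given guard. -/
theorem exists_isChild {C : Set (Vert n)} (hC : C.encard ≤ k) (hk : k < n) (d : Bool)
    {F : Finset ℕ} {v : Vert n} (hv : v.1.length < height n) (hF : F ⊆ Finset.range (height n))
    (hF2 : F.card ≤ 2) (hF3 : (F ∪ guard v.1).card ≤ 3) : ∃ c, IsChild d F v c ∧ c ∉ C := by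
  by_contra! h
  let f : Fin n → Vert n := fun j =>
    ⟨(j, d, ⟨F, Finset.mem_powerset.2 hF⟩) :: v.1, hv, hF2, hF3, v.2⟩
  have hf : Function.Injective f := by
    intro i j hij
    have := congrArg Subtype.val hij
    simp only [f, List.cons.injEq, Prod.mk.injEq] at this
    exact this.1.1
  have hfC : Set.range f ⊆ C := by
    rintro _ ⟨j, rfl⟩
    exact h _ ⟨(j, d, ⟨F, Finset.mem_powerset.2 hF⟩), rfl, rfl, rfl⟩
  have h1 := hf.encard_range.trans ((Set.encard_le_encard hfC).trans hC)
  rw [ENat.card_eq_coe_fintype_card, Fintype.card_fin] at h1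
  exact absurd (by exact_mod_cast h1) (not_le.2 hk)

/-- When the cops come to `v`, the robber can go to a child of `v` with a guard of his choice. -/
theorem Reachable.descend (hσ : IsWinning (guardedTree n) CopMonotone k σ) (hk : k < n)
    {U C : Set (Vert n)} {v : Vert n} (h : Reachable (guardedTree n) σ U C v)
    (hv : v.1.length < height n) :
    ∃ U' C', U ⊆ U' ∧ U \ C ⊆ U' \ C' ∧ v ∈ U' ∧ C'.encard ≤ k ∧
      ∀ d F, F ⊆ Finset.range (height n) → F.card ≤ 2 → (F ∪ guard v.1).card ≤ 3 →
        ∃ c, IsChild d F v c ∧ Reachable (guardedTree n) σ U' C' c := by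
  obtain ⟨U', C', hU, hC, hdis, hvC, hCk, hc⟩ := h.step hσ
  refine ⟨U', C', hU, fun x hx => ⟨hU hx.1, Set.disjoint_right.1 hdis hx⟩, hC hvC, hCk, ?_⟩
  intro d F hF hF2 hF3
  obtain ⟨c, hvc, hcC⟩ := exists_isChild hCk hk d hv hF hF2 hF3
  refine ⟨c, hvc, hc c ?_ ?_ hcC⟩
  · exact Or.inl (hvc.imp fun x hx => hx.1)
  · exact Or.inr (Or.inl (hvc.imp fun x hx => hx.1))

/-- The robber descends through children with the same guard until the cops have left one of the
vertices `p` he has passed. -/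
theorem Reachable.exists_left (hσ : IsWinning (guardedTree n) CopMonotone k σ) (hk : k < n)
    {d : Bool} {F : Finset ℕ} {Φ : Vert n → Prop}
    (hΦ : ∀ v c, IsChild d F v c → Φ v → Φ c) {t : ℕ} :
    ∀ {U C : Set (Vert n)} {v : Vert n} (P : Finset (Vert n)),
      Reachable (guardedTree n) σ U C v → guard v.1 = F → Φ v → P.card + t + 1 = n →
      (∀ p ∈ P, p ∈ U ∧ Φ p ∧ Allowed (!d) p.1 v.1) → v.1.length + t < height n →
      ∃ U' C' p v', U ⊆ U' ∧ U \ C ⊆ U' \ C' ∧ p ∈ U' \ C' ∧ Φ p ∧ Φ v' ∧ guard v'.1 = F ∧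
        v'.1.length ≤ v.1.length + t ∧ (p = v' ∨ Allowed (!d) p.1 v'.1) ∧
        ∀ d F, F ⊆ Finset.range (height n) → F.card ≤ 2 → (F ∪ guard v'.1).card ≤ 3 →
          ∃ c, IsChild d F v' c ∧ Reachable (guardedTree n) σ U' C' c := by
  classical
  induction t with
  | zero =>
    intro U C v P h hg hv hP hPv hlen
    obtain ⟨U', C', hU, hD, hvU, hCk, hc⟩ := h.descend hσ hk hlen
    have hvP : v ∉ P := fun hvP => lt_irrefl _ (hPv v hvP).2.2.suffix.2
    -- These are `n` vertices, all occupied at some time, and there are fewer than `n` cops.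
    have hex : ∃ p ∈ insert v P, p ∉ C' := by
      by_contra! hall
      have h1 := (Set.encard_le_encard (s := ((insert v P : Finset (Vert n)) : Set (Vert n)))
        hall).trans hCk
      rw [Set.encard_coe_eq_coe_finsetCard, Finset.card_insert_of_notMem hvP] at h1
      have h2 : P.card + 1 ≤ k := by exact_mod_cast h1
      omega
    obtain ⟨p, hp, hpC⟩ := hex
    have hp' : p ∈ U' ∧ Φ p ∧ (p = v ∨ Allowed (!d) p.1 v.1) := by
      rcases Finset.mem_insert.1 hp with rfl | hp
      · exact ⟨hvU, hv, Or.inl rfl⟩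
      · exact ⟨hU (hPv p hp).1, (hPv p hp).2.1, Or.inr (hPv p hp).2.2⟩
    exact ⟨U', C', p, v, hU, hD, ⟨hp'.1, hpC⟩, hp'.2.1, hv, hg, le_rfl, hp'.2.2, hc⟩
  | succ t ih =>
    intro U C v P h hg hv hP hPv hlen
    obtain ⟨U', C', hU, hD, hvU, -, hc⟩ := h.descend hσ hk (by omega)
    have hF2 : F.card ≤ 2 := hg ▸ v.2.card_guard_le
    obtain ⟨c, hvc, hcR⟩ := hc d F (hg ▸ guard_subset v.1) hF2
      (by rw [hg, Finset.union_self]; omega)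
    have hvP : v ∉ P := fun hvP => lt_irrefl _ (hPv v hvP).2.2.suffix.2
    have hne : d = !d → False := by cases d <;> simp
    have hlc := hvc.length
    obtain ⟨U'', C'', p, v', hU', hD', hrest⟩ := ih (insert v P) hcR hvc.guard_eq (hΦ v c hvc hv)
      (by rw [Finset.card_insert_of_notMem hvP]; omega) (fun p hp => by
        rcases Finset.mem_insert.1 hp with rfl | hp
        · exact ⟨hvU, hv, hvc.allowed (Or.inl rfl) fun h => (hne h).elim⟩
        · exact ⟨hU (hPv p hp).1, (hPv p hp).2.1,
            hvc.allowed (Or.inr (hPv p hp).2.2) fun h => (hne h).elim⟩) (by omega)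
    refine ⟨U'', C'', p, v', hU.trans hU', hD.trans hD', hrest.1, hrest.2.1, hrest.2.2.1,
      hrest.2.2.2.1, ?_, hrest.2.2.2.2.2⟩
    have := hrest.2.2.2.2.1
    omega

/-- There is a path from `u` to `x` all of whose vertices, except possibly `x`, are in `D`. -/
def PathTo (D : Set (Vert n)) (u x : Vert n) : Prop :=
  Relation.ReflTransGen (fun a b => a ∈ D ∧ (guardedTree n).Adj a b) u x

/-- There is a path from `x` to `u` all of whose vertices, except possibly `x`, are in `D`. -/
def PathFrom (D : Set (Vert n)) (x u : Vert n) : Prop :=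
  Relation.ReflTransGen (fun a b => b ∈ D ∧ (guardedTree n).Adj a b) x u

theorem PathTo.mono {D D' : Set (Vert n)} (h : D ⊆ D') {u x : Vert n} (hp : PathTo D u x) :
    PathTo D' u x :=
  Relation.ReflTransGen.mono (fun _ _ hab => ⟨h hab.1, hab.2⟩) _ _ hp

theorem PathFrom.mono {D D' : Set (Vert n)} (h : D ⊆ D') {u x : Vert n} (hp : PathFrom D x u) :
    PathFrom D' x u :=
  Relation.ReflTransGen.mono (fun _ _ hab => ⟨h hab.1, hab.2⟩) _ _ hp

theorem PathTo.avoiding {D C : Set (Vert n)} (hDC : ∀ x ∈ D, x ∉ C) {u x : Vert n}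
    (hp : PathTo D u x) (hx : x ∉ C) :
    Relation.ReflTransGen (AdjAvoiding (guardedTree n) C) u x ∧ u ∉ C := by
  induction hp using Relation.ReflTransGen.head_induction_on with
  | refl => exact ⟨.refl, hx⟩
  | head hab _ ih => exact ⟨ih.1.head ⟨hDC _ hab.1, ih.2, hab.2⟩, hDC _ hab.1⟩

theorem PathFrom.avoiding {D C : Set (Vert n)} (hDC : ∀ x ∈ D, x ∉ C) {u x : Vert n}
    (hp : PathFrom D x u) (hx : x ∉ C) :
    Relation.ReflTransGen (AdjAvoiding (guardedTree n) C) x u ∧ u ∉ C := by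
  induction hp with
  | refl => exact ⟨.refl, hx⟩
  | tail _ hab ih => exact ⟨ih.1.tail ⟨ih.2, hDC _ hab.1, hab.2⟩, hDC _ hab.1⟩

/-- Each vertex of `K` has been occupied and lies on a closed walk through `v` all of whose other
vertices have been left by the cops. -/
def Forced (U C : Set (Vert n)) (K : Finset (Vert n)) (v : Vert n) : Prop :=
  ∀ x ∈ K, x ∈ U ∧ (∃ p ∈ U \ C, PathFrom (U \ C) x p ∧ Allowed true p.1 v.1) ∧
    ∃ q ∈ U \ C, PathTo (U \ C) q x ∧ Allowed false q.1 v.1 ∧ q.1.length ∈ guard v.1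

/-- The cops cannot leave the vertices of `K`. -/
theorem Forced.subset (hσ : IsWinning (guardedTree n) CopMonotone k σ) {U C : Set (Vert n)}
    {K : Finset (Vert n)} {v : Vert n} (hK : Forced U C K v)
    (h : Reachable (guardedTree n) σ U C v) (hvC : v ∉ C) : (K : Set (Vert n)) ⊆ C := by
  intro x hx
  by_contra hxC
  obtain ⟨hxU, ⟨p, hp, hxp, hpv⟩, q, hq, hqx, hvq, -⟩ := hK x hx
  have hDC : ∀ y ∈ U \ C, y ∉ C := fun y hy => hy.2
  -- The walk `v` → `q` ⇝ `x` ⇝ `p` → `v` would bring `x` back into the robber component.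
  exact h.notMem_scc hσ hxU
    ⟨(hqx.avoiding hDC hxC).1.head ⟨hvC, hq.2, Or.inr (Or.inr (Or.inr hvq))⟩,
      (hxp.avoiding hDC hxC).1.tail ⟨hp.2, hvC, Or.inr (Or.inr (Or.inl hpv))⟩⟩

theorem Reachable.notMem_cops {U C : Set (Vert n)} {v : Vert n}
    (h : Reachable (guardedTree n) σ U C v) : v ∉ C := by
  obtain ⟨p, m, hp, rfl, hv, -⟩ := h
  exact Set.disjoint_left.1 (hp.isComponent ⟨v, hv⟩).prop.2.1 hv

/-- The robber forces the cops to stay on one more vertex. -/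
theorem Forced.exists_succ (hσ : IsWinning (guardedTree n) CopMonotone k σ) (hk : k < n)
    {U C : Set (Vert n)} {K : Finset (Vert n)} {v : Vert n} (hK : Forced U C K v)
    (h : Reachable (guardedTree n) σ U C v) (hg : (guard v.1).card ≤ 1)
    (hlen : v.1.length + (2 * n + 1) ≤ height n) :
    ∃ U' C' K' v', Forced U' C' K' v' ∧ Reachable (guardedTree n) σ U' C' v' ∧
      (guard v'.1).card ≤ 1 ∧ K'.card = K.card + 1 ∧
      v'.1.length ≤ v.1.length + (2 * n + 1) := by
  classical
  obtain ⟨U₁, C₁, hU₁, hD₁, hvU₁, -, hc₁⟩ := h.descend hσ hk (by omega)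
  have hcard : (insert v.1.length (guard v.1)).card ≤ 2 :=
    (Finset.card_insert_le _ _).trans (by omega)
  -- Entering arcs remain free, so the `p` to be found has arcs from `v` and from the old entries.
  -- The depths named keep the arcs to `v` and to the old exits; this is why `Forced` requires the
  -- exits to be in the guard.
  obtain ⟨c₁, hvc₁, hR₁⟩ := hc₁ false (insert v.1.length (guard v.1))
    (Finset.insert_subset (Finset.mem_range.2 (by omega)) (guard_subset _)) hcard
    (by
      rw [Finset.union_eq_left.2 (Finset.subset_insert _ _)]
      omega)
  have hl₁ := hvc₁.length
  let Φ : Vert n → Prop := fun x => Allowed true v.1 x.1 ∧ Allowed false v.1 x.1 ∧ ∀ y ∈ K,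
    (∃ p ∈ U \ C, PathFrom (U \ C) y p ∧ Allowed true p.1 x.1) ∧
      ∃ q ∈ U \ C, PathTo (U \ C) q y ∧ Allowed false q.1 x.1 ∧ q.1.length ∈ guard v.1
  have hΦ : ∀ x c, IsChild false (insert v.1.length (guard v.1)) x c → Φ x → Φ c := by
    rintro x c hxc ⟨h1, h2, h3⟩
    refine ⟨hxc.allowed (Or.inr h1) (by simp), hxc.allowed (Or.inr h2) (by simp), fun y hy => ?_⟩
    obtain ⟨⟨p, hp, hyp, hpx⟩, q, hq, hqy, hqx, hqg⟩ := h3 y hy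
    exact ⟨⟨p, hp, hyp, hxc.allowed (Or.inr hpx) (by simp)⟩, q, hq, hqy,
      hxc.allowed (Or.inr hqx) fun _ => Finset.mem_insert_of_mem hqg, hqg⟩
  have hΦ₁ : Φ c₁ := by
    refine ⟨hvc₁.allowed (Or.inl rfl) (by simp), hvc₁.allowed (Or.inl rfl) (by simp),
      fun y hy => ?_⟩
    obtain ⟨-, ⟨p, hp, hyp, hpv⟩, q, hq, hqy, hqv, hqg⟩ := hK y hy
    exact ⟨⟨p, hp, hyp, hvc₁.allowed (Or.inr hpv) (by simp)⟩, q, hq, hqy,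
      hvc₁.allowed (Or.inr hqv) fun _ => Finset.mem_insert_of_mem hqg, hqg⟩
  obtain ⟨U₂, C₂, p, v₂, hU₂, hD₂, hp, hΦp, hΦv₂, hg₂, hl₂, hpv₂, hc₂⟩ :=
    hR₁.exists_left hσ hk hΦ (t := n - 1) ∅ hvc₁.guard_eq hΦ₁ (by rw [Finset.card_empty]; omega)
      (by simp) (by omega)
  have hlp : p.1.length ≤ v₂.1.length := by
    rcases hpv₂ with rfl | h
    · exact le_rfl
    · exact h.suffix.2.le
  -- Now the entry at `p` is kept and leaving arcs are free. The `q` to be found still has arcs to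
  -- `v` and to the old exits, since the guards of direction `false` passed since `v` name them.
  obtain ⟨c₂, hvc₂, hR₂⟩ := hc₂ true {p.1.length}
    (Finset.singleton_subset_iff.2 (Finset.mem_range.2 (by omega))) (by simp)
    (by
      have := Finset.card_union_le {p.1.length} (guard v₂.1)
      rw [hg₂, Finset.card_singleton] at this
      rw [hg₂]
      omega)
  have hl₂' := hvc₂.length
  let Ψ : Vert n → Prop := fun x => Allowed true p.1 x.1 ∧ Allowed false v.1 x.1 ∧ ∀ y ∈ K,
    ∃ q ∈ U \ C, PathTo (U \ C) q y ∧ Allowed false q.1 x.1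
  have hΨ : ∀ x c, IsChild true {p.1.length} x c → Ψ x → Ψ c := by
    rintro x c hxc ⟨h1, h2, h3⟩
    refine ⟨hxc.allowed (Or.inr h1) (by simp), hxc.allowed (Or.inr h2) (by simp), fun y hy => ?_⟩
    obtain ⟨q, hq, hqy, hqx⟩ := h3 y hy
    exact ⟨q, hq, hqy, hxc.allowed (Or.inr hqx) (by simp)⟩
  have hΨ₂ : Ψ c₂ := by
    refine ⟨hvc₂.allowed hpv₂ (by simp), hvc₂.allowed (Or.inr hΦv₂.2.1) (by simp), fun y hy => ?_⟩
    obtain ⟨-, q, hq, hqy, hqv, -⟩ := hΦv₂.2.2 y hy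
    exact ⟨q, hq, hqy, hvc₂.allowed (Or.inr hqv) (by simp)⟩
  obtain ⟨U₃, C₃, q, v₃, hU₃, hD₃, hq, hΨq, hΨv₃, hg₃, hl₃, hqv₃, hc₃⟩ :=
    hR₂.exists_left hσ hk hΨ (t := n - 1) ∅ hvc₂.guard_eq hΨ₂ (by rw [Finset.card_empty]; omega)
      (by simp) (by omega)
  have hlq : q.1.length ≤ v₃.1.length := by
    rcases hqv₃ with rfl | h
    · exact le_rfl
    · exact h.suffix.2.le
  -- The exit `q` is now the only one needed, so the guard is back to one depth for the next phase.
  obtain ⟨c₃, hvc₃, hR₃⟩ := hc₃ false {q.1.length}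
    (Finset.singleton_subset_iff.2 (Finset.mem_range.2 (by omega))) (by simp)
    (by
      have := Finset.card_union_le {q.1.length} (guard v₃.1)
      rw [hg₃, Finset.card_singleton, Finset.card_singleton] at this
      rw [hg₃]
      omega)
  have hl₃' := hvc₃.length
  have hD : U \ C ⊆ U₃ \ C₃ := hD₁.trans (hD₂.trans hD₃)
  have hvK : v ∉ K := fun hvK => h.notMem_scc hσ (hK v hvK).1 self_mem_scc
  have hpc₃ : Allowed true p.1 c₃.1 := hvc₃.allowed (Or.inr hΨv₃.1) (by simp)
  have hqc₃ : Allowed false q.1 c₃.1 := hvc₃.allowed hqv₃ (by simp)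
  have hqg : q.1.length ∈ guard c₃.1 := by
    rw [hvc₃.guard_eq]
    exact Finset.mem_singleton_self _
  refine ⟨U₃, C₃, insert v K, c₃, fun x hx => ?_, hR₃, by rw [hvc₃.guard_eq]; simp,
    Finset.card_insert_of_notMem hvK, by omega⟩
  rcases Finset.mem_insert.1 hx with rfl | hx
  · exact ⟨hU₃ (hU₂ hvU₁), ⟨p, hD₃ hp, .single ⟨hD₃ hp, Or.inr (Or.inr (Or.inl hΦp.1))⟩, hpc₃⟩,
      q, hq, .single ⟨hq, Or.inr (Or.inr (Or.inr hΨq.2.1))⟩, hqc₃, hqg⟩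
  -- An old vertex is rerouted as `x` ⇝ `p'` → `p` and `q` → `q'` ⇝ `x`.
  · obtain ⟨⟨p', hp', hxp', hp'p⟩, -⟩ := hΦp.2.2 x hx
    obtain ⟨q', hq', hq'x, hq'q⟩ := hΨq.2.2 x hx
    exact ⟨hU₃ (hU₂ (hU₁ (hK x hx).1)),
      ⟨p, hD₃ hp, (hxp'.mono hD).tail ⟨hD₃ hp, Or.inr (Or.inr (Or.inl hp'p))⟩, hpc₃⟩,
      q, hq, (hq'x.mono hD).head ⟨hq, Or.inr (Or.inr (Or.inr hq'q))⟩, hqc₃, hqg⟩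

theorem le_cmDtwCops_guardedTree (n : ℕ) : n ≤ cmDtwCops (guardedTree n) := by
  obtain ⟨σ, hσ⟩ := cmDtwCops_spec (guardedTree n)
  by_contra! hk
  have key : ∀ j ≤ n, ∃ U C K v, Forced U C K v ∧ Reachable (guardedTree n) σ U C v ∧
      (guard v.1).card ≤ 1 ∧ K.card = j ∧ v.1.length ≤ j * (2 * n + 1) := by
    intro j
    induction j with
    | zero =>
      intro _
      exact ⟨∅, ∅, ∅, ⟨[], trivial⟩, fun x hx => absurd hx (Finset.notMem_empty x),
        reachable_start _ _ _, Nat.zero_le _, rfl, Nat.zero_le _⟩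
    | succ j ih =>
      intro hj
      obtain ⟨U, C, K, v, hK, h, hg, hc, hl⟩ := ih (by omega)
      -- A phase takes `2 * n + 1` levels: two descents of at most `n - 1` levels and three single
      -- steps. The tree has room for `n` phases.
      have hle : (j + 1) * (2 * n + 1) ≤ height n := Nat.mul_le_mul_right _ hj
      rw [Nat.succ_mul] at hle ⊢
      obtain ⟨U', C', K', v', hK', h', hg', hc', hl'⟩ := hK.exists_succ hσ hk h hg (by omega)
      exact ⟨U', C', K', v', hK', h', hg', by omega, by omega⟩
  obtain ⟨U, C, K, v, hK, h, -, hc, -⟩ := key n le_rfl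
  have hsub := Set.encard_le_encard (hK.subset hσ h h.notMem_cops)
  obtain ⟨p, m, hp, rfl, -, -⟩ := h
  have := hsub.trans (hσ.1 p m hp m le_rfl)
  rw [Set.encard_coe_eq_coe_finsetCard, hc] at this
  exact absurd (by exact_mod_cast this) (not_le.2 hk)

end Lower

end ComponentGame

theorem mainTheorem3 :
    ∃ (V : ℕ → Type) (_ : ∀ n, Finite (V n)) (G : ∀ n, Digraph (V n)),
      (∀ n, ∀ v, ¬ (G n).Adj v v) ∧
      (∀ n, 2 < n → ComponentGame.dtwCops (G n) ≤ 4 ∧ n ≤ ComponentGame.cmDtwCops (G n)) ∧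
      (∀ c : ℕ, ∃ n, 2 < n ∧ (c : ℤ) ≤ ComponentGame.copMonotonicityCost (G n)) := by
  refine ⟨ComponentGame.Vert, fun n => inferInstance, ComponentGame.guardedTree,
    fun n => ComponentGame.guardedTree_irrefl, fun n _ => ?_, fun c => ⟨c + 4, by omega, ?_⟩⟩
  · exact ⟨ComponentGame.dtwCops_guardedTree_le n, ComponentGame.le_cmDtwCops_guardedTree n⟩
  · have h1 := ComponentGame.dtwCops_guardedTree_le (c + 4)
    have h2 := ComponentGame.le_cmDtwCops_guardedTree (c + 4)
    unfold ComponentGame.copMonotonicityCost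
    omega
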